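/- All graphs are finite and simple. A graph is *matching covered* if it is connected and every edge of it lies in a perfect matching. A subgraph $K$ of a graph $G$ is *conformal* if $G-V(K)$ has a perfect matching. If $v$ is a vertex of degree two of a graph $G$ with neighbours $v_1\neq v_2$, then *bicontracting* $v$ means replacing $v_1,v,v_2$ by one new vertex $u$ that is adjacent to exactly those vertices of $G-\{v_1,v,v_2\}$ that are adjacent to $v_1$ or to $v_2$. For graphs $G$ and $H$ that have perfect matchings, $H$ is a *matching minor* of $G$ if a graph isomorphic to $H$ can be obtained from a conformal subgraph of $G$ by a (possibly empty) sequence of bicontractions. The *cylindrical matching grid* $CG_k$ of order $k$ consists of $k$ disjoint cycles $C_i=(v^i_1,v^i_2,\dots,v^i_{4k})$, $1\le i\le k$, of length $4k$, together with the edges $v^i_jv^{i+1}_{j+1}$ for $1\le i\le k-1$ and $j\in\{1,5,9,\dots,4k-3\}$, and the edges $v^i_jv^{i-1}_{j+1}$ for $2\le i\le k$ and $j\in\{3,7,11,\dots,4k-1\}$. **Theorem.** For every planar bipartite matching covered graph $H$ that has a perfect matching there exists a number $\omega_H\in\mathbb{N}$ such that $H$ is a matching minor of the cylindrical matching grid $CG_{\omega_H}$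 of order $\omega_H$. -/

import Mathlib

namespace MatchingMinors

universe u v

/-- A graph is planar if it can be drawn in the plane: vertices are mapped to distinct points, every
edge `e` is mapped to a simple arc `arc e : [0,1] → ℝ²` joining the points of its two ends, no arc
passes through a vertex in its interior, and the interiors of distinct arcs are disjoint. -/
def IsPlanar {V : Type u} (G : SimpleGraph V) : Prop :=
  ∃ (point : V → ℝ × ℝ) (arc : G.edgeSet → unitInterval → ℝ × ℝ),
    Function.Injective point ∧
    (∀ e, Continuous (arc e)) ∧
    (∀ e, Function.Injective (arc e)) ∧
    (∀ e, s(arc e 0, arc e 1) = (e : Sym2 V).map point) ∧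
    (∀ e, ∀ t ∈ Set.Ioo (0 : unitInterval) 1, arc e t ∉ Set.range point) ∧
    (∀ e e', e ≠ e' → ∀ t ∈ Set.Ioo (0 : unitInterval) 1, ∀ t' ∈ Set.Ioo (0 : unitInterval) 1,
      arc e t ≠ arc e' t')

/-- `G` has a perfect matching. -/
def HasPerfectMatching {V : Type u} (G : SimpleGraph V) : Prop :=
  ∃ M : G.Subgraph, M.IsPerfectMatching

/-- `G` is matching covered: connected, and every edge lies in a perfect matching. -/
def IsMatchingCovered {V : Type u} (G : SimpleGraph V) : Prop :=
  G.Connected ∧ ∀ x y, G.Adj x y → ∃ M : G.Subgraph, M.IsPerfectMatching ∧ M.Adj x y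

/-- A subgraph `K` of `G` is conformal if `G - V(K)` has a perfect matching. -/
def IsConformal {V : Type u} {G : SimpleGraph V} (K : G.Subgraph) : Prop :=
  HasPerfectMatching (G.induce K.vertsᶜ)

/-- The graph obtained from `G` by deleting `x`, `y₁`, `y₂` and adding a new vertex (`none`) that is
adjacent to all remaining neighbours of `y₁` and of `y₂`. If `y₁` and `y₂` are the two neighbours
of the vertex `x` of degree two, then this is the graph obtained by bicontracting `x`. -/
def bicontract {V : Type u} (G : SimpleGraph V) (x y₁ y₂ : V) :
    SimpleGraph (Option {w : V // w ≠ x ∧ w ≠ y₁ ∧ w ≠ y₂}) where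
  Adj
    | some a, some b => G.Adj a b
    | some a, none => G.Adj y₁ a ∨ G.Adj y₂ a
    | none, some b => G.Adj y₁ b ∨ G.Adj y₂ b
    | none, none => False
  symm := ⟨by
    rintro (_ | a) (_ | b) h
    · exact h
    · exact h
    · exact h
    · exact SimpleGraph.Adj.symm (G := G) h⟩
  loopless := ⟨by
    rintro (_ | a) h
    · exact h
    · exact G.loopless.irrefl _ h⟩

/-- `BicontractsTo H G`: a graph isomorphic to `H` is obtained from `G` by a (possibly empty)
sequence of bicontractions of vertices of degree two. -/
inductive BicontractsTo {W : Type v} (H : SimpleGraph W) :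
    ∀ {V : Type u}, SimpleGraph V → Prop
  | iso {V : Type u} (G : SimpleGraph V) (e : G ≃g H) : BicontractsTo H G
  | step {V : Type u} (G : SimpleGraph V) (x y₁ y₂ : V) (hne : y₁ ≠ y₂)
      (hN : G.neighborSet x = {y₁, y₂}) (h : BicontractsTo H (bicontract G x y₁ y₂)) :
      BicontractsTo H G

/-- `H` is a matching minor of `G`: both have perfect matchings, and `H` is obtained (up to
isomorphism) from a conformal subgraph of `G` by a sequence of bicontractions. -/
def IsMatchingMinor {W : Type v} {V : Type u} (H : SimpleGraph W) (G : SimpleGraph V) : Prop :=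
  HasPerfectMatching G ∧ HasPerfectMatching H ∧
    ∃ K : G.Subgraph, IsConformal K ∧ BicontractsTo H K.coe

/-- The cylindrical matching grid of order `k`. The pair `(i, j)` stands for the vertex
`v^{i+1}_{j+1}` (indices start at `0` here), so the congruences `j ≡ 1, 3 (mod 4)` of the
one-based indexing become `j ≡ 0, 2 (mod 4)`. -/
def cylindricalMatchingGrid (k : ℕ) : SimpleGraph (Fin k × Fin (4 * k)) :=
  SimpleGraph.fromRel fun p q =>
    (p.1 = q.1 ∧ (q.2 : ℕ) = ((p.2 : ℕ) + 1) % (4 * k)) ∨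
    ((q.1 : ℕ) = (p.1 : ℕ) + 1 ∧ (p.2 : ℕ) % 4 = 0 ∧ (q.2 : ℕ) = (p.2 : ℕ) + 1) ∨
    ((p.1 : ℕ) = (q.1 : ℕ) + 1 ∧ (p.2 : ℕ) % 4 = 2 ∧ (q.2 : ℕ) = (p.2 : ℕ) + 1)

end MatchingMinors

/-!
Let `G` be the cylindrical matching grid. Contracting the edges of a perfect matching of a bipartite
graph, and directing the other edges from the even to the odd colour class, gives a digraph. For the
perfect matching of `G` that shifts its direction from row to row this digraph is, away from the
boundary, the digraph `HexArc` on `ℤ × ℤ`. It has arcs in all directions of the plane: there are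
disjoint strongly connected sets of bounded size, the tiles, indexed by `ℤ × ℤ`, such that adjacent
tiles are joined by arcs both ways (`stronglyConnectedOn_tile`, `GridAdj.exists_hexArc`).

A drawing of the planar graph `H` turns into a minor model of `H` in the square grid with vertex set
`ℤ × ℤ` (`IsPlanar.exists_gridModel`). This needs no separation theorem: outside small balls around
the vertices the arcs of the drawing are disjoint compact sets, so a fine enough grid keeps them
apart. Replacing the points of `ℤ × ℤ` by tiles, every vertex of `H` receives a strongly connected
set of vertices of `HexArc`, and sets of adjacent vertices are joined by arcs both ways.

Fix a perfect matching of `H`. Inside the set of a black vertex of `H` there is a spanning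
arborescence directed away from its root, inside that of a white vertex one directed towards its
root, and the roots can be chosen such that each matching edge of `H` has an arc from its white root
to its black root. Undoing the contraction, these arborescences become trees in `G` in which every
second vertex has degree two. Together with the edges of `G` that represent arcs from black to white
sets they form a subgraph of `G` that is a union of edges of the perfect matching and hence
conformal, and bicontracting the trees from their leaves to their roots gives `H`
(`Arborescences.nonempty_treeModel`, `TreeModel.bicontractsTo`).
-/

namespace MatchingMinors

/-! ### Contracting subdivided trees -/

/-- A way of seeing `H` as the graph obtained from `G` by contracting disjoint trees, in a form that
bicontractions can carry out. The vertices of `G` are split into minor and major ones. A minor vertex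
`x` has degree two; its two neighbours `up x` and `lo x` are major, lie in the same branch set, and
`rk` decreases from `up x` to `lo x`. Every branch set has just one major vertex that is not of the
form `up x`, so that joining `up x` to `lo x` for all minor `x` turns the major vertices of a branch
set into a rooted tree. Adjacency of major vertices is adjacency in `H`. -/
structure TreeModel {U W : Type*} (G : SimpleGraph U) (H : SimpleGraph W) where
  branch : U → W
  minor : U → Prop
  up : U → U
  lo : U → U
  rk : U → ℕ
  up_major : ∀ {x}, minor x → ¬ minor (up x)
  lo_major : ∀ {x}, minor x → ¬ minor (lo x)
  branch_up : ∀ {x}, minor x → branch (up x) = branch (lo x)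
  rk_lt : ∀ {x}, minor x → rk (lo x) < rk (up x)
  adj_iff : ∀ {x}, minor x → ∀ z, G.Adj x z ↔ z = up x ∨ z = lo x
  up_inj : ∀ {x x'}, minor x → minor x' → up x = up x' → x = x'
  root_unique : ∀ {y y'}, ¬ minor y → ¬ minor y' → branch y = branch y' →
    (∀ x, minor x → up x ≠ y) → (∀ x, minor x → up x ≠ y') → y = y'
  surj : ∀ w, ∃ y, ¬ minor y ∧ branch y = w
  adj_branch : ∀ {y y'}, ¬ minor y → ¬ minor y' → G.Adj y y' → H.Adj (branch y) (branch y')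
  adj_lift : ∀ {w w'}, H.Adj w w' →
    ∃ y y', ¬ minor y ∧ ¬ minor y' ∧ branch y = w ∧ branch y' = w' ∧ G.Adj y y'

namespace TreeModel

variable {U U' W : Type*} {G : SimpleGraph U} {G' : SimpleGraph U'} {H : SimpleGraph W}

/-- Tree models are transported along isomorphisms. -/
def comapIso (T : TreeModel G H) (e : G' ≃g G) : TreeModel G' H where
  branch a := T.branch (e a)
  minor a := T.minor (e a)
  up a := e.symm (T.up (e a))
  lo a := e.symm (T.lo (e a))
  rk a := T.rk (e a)
  up_major h := by simpa using T.up_major h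
  lo_major h := by simpa using T.lo_major h
  branch_up h := by simpa using T.branch_up h
  rk_lt h := by simpa using T.rk_lt h
  adj_iff h z := by
    rw [← e.map_adj_iff, T.adj_iff h]
    exact or_congr (e.toEquiv.eq_symm_apply (y := z)).symm (e.toEquiv.eq_symm_apply (y := z)).symm
  up_inj h h' hx := e.injective (T.up_inj h h' (e.symm.injective hx))
  root_unique h h' hb hy hy' := e.injective <| T.root_unique h h' hb
    (fun x hx hxy => hy (e.symm x) (by simpa using hx) (by simp [hxy]))
    (fun x hx hxy => hy' (e.symm x) (by simpa using hx) (by simp [hxy]))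
  surj w := by
    obtain ⟨y, hy⟩ := T.surj w
    exact ⟨e.symm y, by simpa using hy⟩
  adj_branch h h' ha := T.adj_branch h h' (e.map_adj_iff.2 ha)
  adj_lift h := by
    obtain ⟨y, y', h1, h2, h3, h4, h5⟩ := T.adj_lift h
    exact ⟨e.symm y, e.symm y', by simpa using h1, by simpa using h2, by simpa using h3,
      by simpa using h4, e.symm.map_adj_iff.2 h5⟩

/-- The vertex of `G` that represents a vertex of the bicontraction: the new vertex is represented
by `p`. -/
def bicontractRep {x y p : U} : Option {w : U // w ≠ x ∧ w ≠ y ∧ w ≠ p} → U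
  | none => p
  | some a => a

theorem bicontractRep_injective {x y p : U} :
    Function.Injective (bicontractRep (x := x) (y := y) (p := p)) := by
  rintro (_ | a) (_ | b) h
  · rfl
  · exact absurd h.symm b.2.2.2
  · exact absurd h a.2.2.2
  · exact congrArg some (Subtype.ext h)

theorem bicontractRep_ne {x y p : U} (hx : p ≠ x) (hy : p ≠ y)
    (a : Option {w : U // w ≠ x ∧ w ≠ y ∧ w ≠ p}) :
    bicontractRep a ≠ x ∧ bicontractRep a ≠ y := by
  rcases a with _ | a
  · exact ⟨hx, hy⟩
  · exact ⟨a.2.1, a.2.2.1⟩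

theorem exists_bicontractRep {x y p a : U} (hx : a ≠ x) (hy : a ≠ y) :
    ∃ a' : Option {w : U // w ≠ x ∧ w ≠ y ∧ w ≠ p}, bicontractRep a' = a := by
  by_cases h : a = p
  · exact ⟨none, h.symm⟩
  · exact ⟨some ⟨a, hx, hy, h⟩, rfl⟩

theorem bicontract_adj {x y p : U} (hyp : ¬ G.Adj y p)
    (a b : Option {w : U // w ≠ x ∧ w ≠ y ∧ w ≠ p}) :
    (bicontract G x y p).Adj a b ↔ G.Adj (bicontractRep a) (bicontractRep b) ∨
      (bicontractRep a = p ∧ G.Adj y (bicontractRep b)) ∨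
      (bicontractRep b = p ∧ G.Adj y (bicontractRep a)) := by
  rcases a with _ | a <;> rcases b with _ | b
  · simp [bicontract, bicontractRep, hyp]
  · have := b.2.2.2
    simp [bicontract, bicontractRep, this, or_comm]
  · have := a.2.2.2
    simp [bicontract, bicontractRep, this, or_comm, G.adj_comm]
  · have := a.2.2.2
    have := b.2.2.2
    simp [bicontract, bicontractRep, *]

/-- Bicontracting a minor vertex `x` whose upper neighbour has maximal rank gives a tree model: the
upper neighbour is then a leaf of its tree, which gets merged into its parent. -/
theorem exists_contract (T : TreeModel G H) {x : U} (hx : T.minor x)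
    (hmax : ∀ x', T.minor x' → T.rk (T.up x') ≤ T.rk (T.up x)) :
    Nonempty (TreeModel (bicontract G x (T.up x) (T.lo x)) H) := by
  classical
  have hpx : T.lo x ≠ x := fun h => T.lo_major hx (h.symm ▸ hx)
  have hpy : T.lo x ≠ T.up x := fun h => (T.rk_lt hx).ne (congrArg T.rk h)
  have hlo : ∀ {x'}, T.minor x' → T.lo x' ≠ T.up x := fun {x'} h h' =>
    ((T.rk_lt h).trans_le (hmax x' h)).ne (congrArg T.rk h')
  have hne : ∀ {a}, ¬ T.minor a → a ≠ x := fun h h' => h (h' ▸ hx)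
  have hyp : ¬ G.Adj (T.up x) (T.lo x) := fun h =>
    (T.adj_branch (T.up_major hx) (T.lo_major hx) h).ne (T.branch_up hx)
  let q := bicontractRep (x := x) (y := T.up x) (p := T.lo x)
  have hq : ∀ a, q a ≠ x ∧ q a ≠ T.up x := bicontractRep_ne hpx hpy
  have qinj : Function.Injective q := bicontractRep_injective
  have hadj := bicontract_adj (x := x) hyp
  let π : U → Option {w : U // w ≠ x ∧ w ≠ T.up x ∧ w ≠ T.lo x} := Function.invFun q
  have hπ : ∀ {a}, a ≠ x → a ≠ T.up x → q (π a) = a := fun h h' =>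
    Function.invFun_eq (exists_bicontractRep h h')
  have hupne : ∀ {a}, T.minor (q a) → T.up (q a) ≠ T.up x := fun {a} h h' =>
    (hq a).1 (T.up_inj h hx h')
  have hup : ∀ {a}, T.minor (q a) → q (π (T.up (q a))) = T.up (q a) := fun {a} h =>
    hπ (hne (T.up_major h)) (hupne h)
  have hlo' : ∀ {a}, T.minor (q a) → q (π (T.lo (q a))) = T.lo (q a) := fun {a} h =>
    hπ (hne (T.lo_major h)) (hlo h)
  -- A vertex that is not an upper neighbour in the contracted graph was none before either.
  have hroot : ∀ {a}, (∀ x', T.minor (q x') → π (T.up (q x')) ≠ a) →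
      ∀ x', T.minor x' → T.up x' ≠ q a := by
    intro a h x' hx' h'
    by_cases hxx : x' = x
    · exact (hq a).2 (by rw [← h', hxx])
    · obtain ⟨z, rfl⟩ := exists_bicontractRep (p := T.lo x) hxx
        (fun h2 => T.up_major hx (h2 ▸ hx') : x' ≠ T.up x)
      exact h z hx' (qinj ((hup (a := z) hx').trans h'))
  refine ⟨{ branch := fun a => T.branch (q a), minor := fun a => T.minor (q a),
            up := fun a => π (T.up (q a)), lo := fun a => π (T.lo (q a)),
            rk := fun a => T.rk (q a), up_major := ?_, lo_major := ?_,
            branch_up := ?_, rk_lt := ?_, adj_iff := ?_, up_inj := ?_, root_unique := ?_,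
            surj := ?_, adj_branch := ?_, adj_lift := ?_ }⟩
  · intro a h; rw [hup h]; exact T.up_major h
  · intro a h; rw [hlo' h]; exact T.lo_major h
  · intro a h; rw [hup h, hlo' h]; exact T.branch_up h
  · intro a h; rw [hup h, hlo' h]; exact T.rk_lt h
  · intro a h z
    rw [← qinj.eq_iff (a := z), ← qinj.eq_iff (a := z), hup h, hlo' h, ← T.adj_iff h, hadj]
    refine or_iff_left ?_
    rintro (⟨h1, -⟩ | ⟨-, h1⟩)
    · exact T.lo_major hx (h1 ▸ h)
    · rcases (T.adj_iff h _).1 h1.symm with h2 | h2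
      · exact hupne h h2.symm
      · exact hlo h h2.symm
  · intro a b h h' hab
    refine qinj (T.up_inj h h' ?_)
    rw [← hup h, ← hup h']
    exact congrArg q hab
  · intro a b h h' hb h1 h2
    exact qinj (T.root_unique h h' hb (hroot h1) (hroot h2))
  · intro w
    obtain ⟨y, hy, rfl⟩ := T.surj w
    by_cases hyy : y = T.up x
    · exact ⟨none, T.lo_major hx, by rw [hyy, T.branch_up hx]; rfl⟩
    · obtain ⟨a, rfl⟩ := exists_bicontractRep (p := T.lo x) (hne hy) hyy
      exact ⟨a, hy, rfl⟩
  · intro a b h h' hab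
    rcases (hadj a b).1 hab with h1 | ⟨h1, h2⟩ | ⟨h1, h2⟩
    · exact T.adj_branch h h' h1
    · have := T.adj_branch (T.up_major hx) h' h2
      rw [T.branch_up hx, ← h1] at this
      exact this
    · have := T.adj_branch (T.up_major hx) h h2
      rw [T.branch_up hx, ← h1] at this
      exact this.symm
  · intro w w' hw
    -- An edge at the merged vertex `up x` becomes an edge at the new vertex `none`.
    obtain ⟨y, y', h, h', rfl, rfl, hyy⟩ := T.adj_lift hw
    have key : ∀ y, ¬ T.minor y → ∃ a, ¬ T.minor (q a) ∧ T.branch (q a) = T.branch y ∧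
        ((y = T.up x ∧ q a = T.lo x) ∨ q a = y) := by
      intro y h
      by_cases hy : y = T.up x
      · exact ⟨none, T.lo_major hx, by rw [hy, T.branch_up hx]; rfl, .inl ⟨hy, rfl⟩⟩
      · obtain ⟨a, ha⟩ := exists_bicontractRep (p := T.lo x) (hne h) hy
        exact ⟨a, by rw [← ha] at h; exact h, congrArg T.branch ha, .inr ha⟩
    obtain ⟨a, ha, hab, ha'⟩ := key y h
    obtain ⟨b, hb, hbb, hb'⟩ := key y' h'
    refine ⟨a, b, ha, hb, hab, hbb, (hadj a b).2 ?_⟩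
    rcases ha' with ⟨rfl, ha'⟩ | ha' <;> rcases hb' with ⟨rfl, hb'⟩ | hb'
    · exact absurd hyy (G.irrefl)
    · exact .inr (.inl ⟨ha', by rw [show bicontractRep b = y' from hb']; exact hyy⟩)
    · exact .inr (.inr ⟨hb', by rw [show bicontractRep a = y from ha']; exact hyy.symm⟩)
    · refine .inl ?_
      rw [show bicontractRep a = y from ha', show bicontractRep b = y' from hb']
      exact hyy

end TreeModel

universe u v in
theorem TreeModel.bicontractsTo {U : Type u} {W : Type v} [Finite U] {G : SimpleGraph U}
    {H : SimpleGraph W} (T : TreeModel G H) : BicontractsTo H G := by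
  induction hn : Nat.card U using Nat.strong_induction_on generalizing U with
  | _ n ih =>
    by_cases h : ∃ x, T.minor x
    · obtain ⟨x, hx, hmax⟩ := Set.exists_max_image {x | T.minor x} (fun x => T.rk (T.up x))
        (Set.toFinite _) h
      obtain ⟨T'⟩ := T.exists_contract hx hmax
      have hne : T.up x ≠ T.lo x := fun h => (T.rk_lt hx).ne' (congrArg T.rk h)
      have hpx : T.lo x ≠ x := fun h => T.lo_major hx (h.symm ▸ hx)
      refine .step G x (T.up x) (T.lo x) hne (Set.ext fun z => T.adj_iff hx z) ?_
      refine ih _ ?_ T' rfl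
      have := Fintype.ofFinite U
      have := Fintype.ofFinite (Option {w : U // w ≠ x ∧ w ≠ T.up x ∧ w ≠ T.lo x})
      rw [← hn, Nat.card_eq_fintype_card, Nat.card_eq_fintype_card]
      refine Fintype.card_lt_of_injective_of_notMem _ bicontractRep_injective (b := x) ?_
      rintro ⟨a, ha⟩
      exact (bicontractRep_ne hpx hne.symm a).1 ha
    · have hmaj : ∀ y, ¬ T.minor y := fun y hy => h ⟨y, hy⟩
      have hinj : Function.Injective T.branch := fun y y' hy =>
        T.root_unique (hmaj y) (hmaj y') hy (fun x hx => absurd hx (hmaj x))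
          (fun x hx => absurd hx (hmaj x))
      have hsurj : Function.Surjective T.branch := fun w =>
        let ⟨y, hy⟩ := T.surj w
        ⟨y, hy.2⟩
      refine .iso G ⟨Equiv.ofBijective T.branch ⟨hinj, hsurj⟩, ?_⟩
      intro a b
      refine ⟨fun hab => ?_, fun hab => T.adj_branch (hmaj a) (hmaj b) hab⟩
      obtain ⟨y, y', -, -, hy, hy', hyy⟩ := T.adj_lift hab
      rwa [← hinj hy, ← hinj hy']

/-! ### Strong minors of digraphs -/

/-- An arc of the relation `R` with both ends in `S`. -/
def StepIn {X : Type*} (R : X → X → Prop) (S : Set X) (a b : X) : Prop :=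
  a ∈ S ∧ b ∈ S ∧ R a b

/-- The digraph with arc relation `R` induces a strongly connected digraph on `S`. -/
def StronglyConnectedOn {X : Type*} (R : X → X → Prop) (S : Set X) : Prop :=
  ∀ a ∈ S, ∀ b ∈ S, Relation.ReflTransGen (StepIn R S) a b

/-- If every vertex of `S` is reachable from `r` inside `S`, then `S` is spanned by an arborescence
rooted at `r`, here given by a parent function and a rank that witnesses its well-foundedness. -/
theorem exists_arborescence {X : Type*} {R : X → X → Prop} {S : Set X} {r : X}
    (h : ∀ t ∈ S, Relation.ReflTransGen (StepIn R S) r t) :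
    ∃ (par : X → X) (rk : X → ℕ), ∀ t ∈ S, t ≠ r → par t ∈ S ∧ R (par t) t ∧ rk (par t) < rk t := by
  classical
  let reach : ℕ → Set X := fun n => Nat.rec {r} (fun _ A => {t | ∃ s ∈ A, StepIn R S s t}) n
  have hex : ∀ t, Relation.ReflTransGen (StepIn R S) r t → ∃ n, t ∈ reach n := by
    intro t ht
    induction ht with
    | refl => exact ⟨0, rfl⟩
    | tail _ hst ih =>
      obtain ⟨n, hn⟩ := ih
      exact ⟨n + 1, _, hn, hst⟩
  let rk : X → ℕ := fun t => sInf {n | t ∈ reach n}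
  have key : ∀ t, t ∈ S → t ≠ r → ∃ s, s ∈ S ∧ R s t ∧ rk s < rk t := by
    intro t ht htr
    have hmem : t ∈ reach (rk t) := Nat.sInf_mem (s := {n | t ∈ reach n}) (hex t (h t ht))
    cases hn : rk t with
    | zero => rw [hn] at hmem; exact absurd hmem htr
    | succ n =>
      rw [hn] at hmem
      obtain ⟨s, hs, hsS, -, hst⟩ := hmem
      exact ⟨s, hsS, hst, Nat.lt_succ_of_le (Nat.sInf_le hs)⟩
  choose! par hpar using key
  exact ⟨par, rk, hpar⟩

section StrongMinor

variable {X W : Type*} {H : SimpleGraph W} {black : W → Prop} {mate : W → W} {own : X → W}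
  {R : X → X → Prop}

/-- A choice of arborescences in strongly connected branch sets: those of black vertices are directed
away from the root, those of white vertices towards the root, and every edge of the given perfect
matching of `H` is represented by an arc from the white root to the black root. -/
structure Arborescences (black : W → Prop) (mate : W → W) (own : X → W) (R : X → X → Prop) where
  root : W → X
  par : X → X
  rk : X → ℕ
  own_root : ∀ w, own (root w) = w
  arc_root : ∀ {w}, black w → R (root (mate w)) (root w)
  own_par : ∀ {t}, t ≠ root (own t) → own (par t) = own t
  arc_black : ∀ {t}, black (own t) → t ≠ root (own t) → R (par t) t
  arc_white : ∀ {t}, ¬ black (own t) → t ≠ root (own t) → R t (par t)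
  rk_par : ∀ {t}, t ≠ root (own t) → rk (par t) < rk t

theorem exists_arborescences (hcol : ∀ {v w}, H.Adj v w → (black v ↔ ¬ black w))
    (hmate : ∀ w, H.Adj w (mate w)) (hinv : ∀ w, mate (mate w) = w)
    (hsc : ∀ w, StronglyConnectedOn R {t | own t = w})
    (harc : ∀ {v w}, H.Adj v w → ∃ s t, own s = v ∧ own t = w ∧ R s t) :
    Nonempty (Arborescences black mate own R) := by
  classical
  have h1 : ∀ w, ∃ s t, own s = mate w ∧ own t = w ∧ R s t := fun w => harc (hmate w).symm
  choose σ τ hσ hτ hR using h1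
  let root : W → X := fun w => if black w then τ w else σ (mate w)
  have own_root : ∀ w, own (root w) = w := by
    intro w
    by_cases hw : black w
    · simp [root, hw, hτ]
    · simp [root, hw, hσ, hinv]
  have h2 : ∀ w, ∃ (par : X → X) (rk : X → ℕ), ∀ t ∈ {t | own t = w}, t ≠ root w →
      par t ∈ {t | own t = w} ∧ (if black w then R (par t) t else R t (par t)) ∧
        rk (par t) < rk t := by
    intro w
    by_cases hw : black w
    · obtain ⟨par, rk, h⟩ := exists_arborescence (R := R) (S := {t | own t = w}) (r := root w)
        fun t ht => hsc w _ (own_root w) t ht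
      exact ⟨par, rk, by simpa [hw] using h⟩
    · obtain ⟨par, rk, h⟩ := exists_arborescence (R := Function.swap R) (S := {t | own t = w})
        (r := root w) fun t ht => by
          rw [← Relation.reflTransGen_swap]
          refine Relation.ReflTransGen.mono ?_ _ _ (hsc w t ht _ (own_root w))
          exact fun a b hab => ⟨hab.2.1, hab.1, hab.2.2⟩
      exact ⟨par, rk, by simpa [hw, Function.swap] using h⟩
  choose par rk h using h2
  exact ⟨{
    root := root
    par := fun t => par (own t) t
    rk := fun t => rk (own t) t
    own_root := own_root
    arc_root := by
      intro w hw
      have hw' : ¬ black (mate w) := (hcol (hmate w)).1 hw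
      simpa [root, hw, hw', hinv] using hR w
    own_par := fun {t} ht => (h (own t) t rfl ht).1
    arc_black := fun {t} hb ht => by simpa [hb] using (h (own t) t rfl ht).2.1
    arc_white := fun {t} hb ht => by simpa [hb] using (h (own t) t rfl ht).2.1
    rk_par := fun {t} ht => by
      obtain ⟨h1, -, h3⟩ := h (own t) t rfl ht
      rwa [show own (par (own t) t) = own t from h1] }⟩

namespace Arborescences

/-- The arcs `s → t` of the digraph used to model `H`, including `t → t`, which stands for the
matching edge at `t`. -/
def Arc (A : Arborescences black mate own R) (H : SimpleGraph W) (s t : X) : Prop :=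
  s = t ∨ (black (own t) ∧ t ≠ A.root (own t) ∧ s = A.par t) ∨
  (¬ black (own s) ∧ s ≠ A.root (own s) ∧ t = A.par s) ∨
  (black (own s) ∧ ¬ black (own t) ∧ H.Adj (own s) (own t) ∧ R s t) ∨
  (¬ black (own s) ∧ s = A.root (own s) ∧ t = A.root (mate (own s)))

/-- The bipartite graph of the digraph `A.Arc H`: every vertex `t` is replaced by an edge joining
`Sum.inl t` and `Sum.inr t`, and every arc `s → t` by an edge joining `Sum.inr s` and `Sum.inl t`. -/
def graph (A : Arborescences black mate own R) (H : SimpleGraph W) : SimpleGraph (X ⊕ X) where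
  Adj
    | .inr s, .inl t => A.Arc H s t
    | .inl t, .inr s => A.Arc H s t
    | _, _ => False
  symm := ⟨by rintro (a | a) (b | b) h <;> exact h⟩
  loopless := ⟨by rintro (a | a) h <;> exact h⟩

theorem Arc.eq_or_rel {A : Arborescences black mate own R}
    (hmb : ∀ {w}, ¬ black w → black (mate w)) (hinv : ∀ w, mate (mate w) = w) {s t : X}
    (h : A.Arc H s t) : s = t ∨ R s t := by
  rcases h with h | ⟨h1, h2, h⟩ | ⟨h1, h2, h⟩ | ⟨-, -, -, h⟩ | ⟨h1, h2, h⟩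
  · exact .inl h
  · exact .inr (h ▸ A.arc_black h1 h2)
  · exact .inr (h ▸ A.arc_white h1 h2)
  · exact .inr h
  · have := A.arc_root (hmb h1)
    rw [hinv, ← h2, ← h] at this
    exact .inr this

open Classical in
/-- The branch set of a vertex of `A.graph H`: that of its digraph vertex, except that `Sum.inl r_b`
for the root `r_b` of a black vertex `b` belongs to the branch set of the mate of `b`. -/
noncomputable def branch (A : Arborescences black mate own R) : X ⊕ X → W
  | .inl t => if black (own t) ∧ t = A.root (own t) then mate (own t) else own t
  | .inr t => own t

/-- The vertices to be bicontracted: `Sum.inl t` in the arborescence of a black vertex, unless `t` is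
the root, and `Sum.inr t` in the arborescence of a white vertex. -/
def IsMinor (A : Arborescences black mate own R) : X ⊕ X → Prop
  | .inl t => black (own t) ∧ t ≠ A.root (own t)
  | .inr t => ¬ black (own t)

open Classical in
/-- The upper neighbour of a minor vertex. -/
noncomputable def up (A : Arborescences black mate own R) : X ⊕ X → X ⊕ X
  | .inl t => .inr t
  | .inr s => .inl (if s = A.root (own s) then A.root (mate (own s)) else s)

/-- A major vertex that is not an upper neighbour is determined by its branch set. -/
theorem eq_root_of_forall_up_ne (A : Arborescences black mate own R)
    (hbm : ∀ {w}, black w → ¬ black (mate w)) (hinv : ∀ w, mate (mate w) = w) {y : X ⊕ X}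
    (hy : ¬ A.IsMinor y) (hup : ∀ x, A.IsMinor x → A.up x ≠ y) :
    (black (A.branch y) ∧ y = .inr (A.root (A.branch y))) ∨
      (¬ black (A.branch y) ∧ y = .inl (A.root (A.branch y))) := by
  rcases y with t | t
  · simp only [IsMinor, not_and_not_right] at hy
    by_cases hb : black (own t)
    · refine absurd ?_ (hup (.inr (A.root (mate (own t)))) ?_)
      · simp [up, A.own_root, hinv, ← hy hb]
      · simpa [IsMinor, A.own_root] using hbm hb
    · by_cases ht : t = A.root (own t)
      · simp [branch, hb, ← ht]
      · refine absurd ?_ (hup (.inr t) hb)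
        simp [up, ht]
  · simp only [IsMinor, not_not] at hy
    by_cases ht : t = A.root (own t)
    · simp [branch, hy, ← ht]
    · exact absurd rfl (hup (.inl t) ⟨hy, ht⟩)

/-- Contracting the arborescences of `A.graph H` gives `H`. In the branch set of a black vertex the
vertices `Sum.inr t` are major, in that of a white vertex the vertices `Sum.inl t`. For a matching
edge `bw` of `H` with roots `r_b` and `r_w` the vertex `Sum.inl r_b` is moved to the branch set of
`w`, where it hangs at `Sum.inl r_w` by the minor vertex `Sum.inr r_w`. -/
theorem nonempty_treeModel (A : Arborescences black mate own R)
    (hcol : ∀ {v w}, H.Adj v w → (black v ↔ ¬ black w))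
    (hmate : ∀ w, H.Adj w (mate w)) (hinv : ∀ w, mate (mate w) = w)
    (harc : ∀ {v w}, H.Adj v w → ∃ s t, own s = v ∧ own t = w ∧ R s t) :
    Nonempty (TreeModel (A.graph H) H) := by
  classical
  have hbm : ∀ {w}, black w → ¬ black (mate w) := fun {w} => (hcol (hmate w)).1
  have hmb : ∀ {w}, ¬ black w → black (mate w) := fun {w} => (hcol (hmate w).symm).2
  refine ⟨{
    branch := A.branch
    minor := A.IsMinor
    up := A.up
    lo := fun
      | .inl t => .inr (A.par t)
      | .inr s => .inl (if s = A.root (own s) then s else A.par s)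
    rk := fun
      | .inl t => if black (own t) then A.rk (A.root (mate (own t))) + 1 else A.rk t
      | .inr t => A.rk t
    up_major := ?_, lo_major := ?_, branch_up := ?_, rk_lt := ?_, adj_iff := ?_, up_inj := ?_
    root_unique := ?_, surj := ?_, adj_branch := ?_, adj_lift := ?_ }⟩
  · rintro (t | s) h
    · simpa [up, IsMinor] using h.1
    · by_cases hs : s = A.root (own s)
      · simp [up, IsMinor, ← hs, A.own_root]
      · simp only [up, hs, if_false]
        exact fun h' => h h'.1
  · rintro (t | s) h
    · simpa [IsMinor, A.own_par h.2] using h.1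
    · by_cases hs : s = A.root (own s)
      · simp [IsMinor, ← hs]
      · simp only [IsMinor, hs, if_false, A.own_par hs]
        exact fun h' => h h'.1
  · rintro (t | s) h
    · simp [branch, up, A.own_par h.2]
    · have h' : ¬ black (own s) := h
      by_cases hs : s = A.root (own s)
      · simp [branch, up, ← hs, A.own_root, hmb h', hinv, h']
      · simp [branch, up, hs, h', A.own_par hs]
  · rintro (t | s) h
    · exact A.rk_par h.2
    · have h' : ¬ black (own s) := h
      by_cases hs : s = A.root (own s)
      · simp [up, ← hs, A.own_root, hmb h', hinv, h']
      · simp [up, hs, h', A.own_par hs, A.rk_par hs]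
  · rintro (t | s) h (z | z)
    · simp [graph, up]
    · obtain ⟨h1, h2⟩ := h
      simp only [graph, up, Arc, Sum.inr.injEq, h1, not_true, false_and, and_false, false_or,
        true_and, ne_eq, h2, not_false_eq_true]
      refine or_congr_right (or_iff_left ?_)
      rintro (⟨h3, h4, h5⟩ | ⟨-, -, h5⟩)
      · rw [h5, A.own_par h4] at h1
        exact h3 h1
      · exact h2 (by rw [h5, A.own_root])
    · have h' : ¬ black (own s) := h
      simp only [graph, up, Arc, Sum.inl.injEq, h', not_false_eq_true, true_and, false_and, false_or]
      have h0 : ¬ (black (own z) ∧ z ≠ A.root (own z) ∧ s = A.par z) := by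
        rintro ⟨h1, h2, h3⟩
        rw [h3, A.own_par h2] at h'
        exact h' h1
      rw [eq_comm (a := s) (b := z)]
      by_cases hs : s = A.root (own s)
      · simp only [h0, if_pos hs, false_or]
        tauto
      · simp only [h0, if_neg hs, false_or]
        tauto
    · simp [graph, up]
  · rintro (t | s) (t' | s') h h' hu
    · simpa [up] using hu
    · simp [up] at hu
    · simp [up] at hu
    · have h1 : ¬ black (own s) := h
      have h1' : ¬ black (own s') := h'
      -- The black root `r_b` is not a vertex of a white branch set.
      have key : ∀ {a b : X}, ¬ black (own a) → ¬ black (own b) → A.root (mate (own a)) ≠ b := by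
        rintro a b ha hb rfl
        rw [A.own_root] at hb
        exact hb (hmb ha)
      by_cases hs : s = A.root (own s) <;> by_cases hs' : s' = A.root (own s')
      · simp only [up, if_pos hs, if_pos hs', Sum.inl.injEq] at hu
        have h2 := congrArg own hu
        rw [A.own_root, A.own_root] at h2
        have h3 := congrArg mate h2
        rw [hinv, hinv] at h3
        rw [hs, hs', h3]
      · simp only [up, if_pos hs, if_neg hs', Sum.inl.injEq] at hu
        exact absurd hu (key h1 h1')
      · simp only [up, if_neg hs, if_pos hs', Sum.inl.injEq] at hu
        exact absurd hu.symm (key h1' h1)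
      · simp only [up, if_neg hs, if_neg hs', Sum.inl.injEq] at hu
        rw [hu]
  · intro y y' h h' hb hr hr'
    have h1 := A.eq_root_of_forall_up_ne hbm hinv h hr
    have h2 := A.eq_root_of_forall_up_ne hbm hinv h' hr'
    rw [← hb] at h2
    rcases h1 with ⟨h1, h3⟩ | ⟨h1, h3⟩ <;> rcases h2 with ⟨h2, h4⟩ | ⟨h2, h4⟩
    · rw [h3, h4]
    · exact absurd h1 h2
    · exact absurd h2 h1
    · rw [h3, h4]
  · intro w
    by_cases hw : black w
    · exact ⟨.inr (A.root w), by simpa [IsMinor, A.own_root] using hw, A.own_root w⟩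
    · exact ⟨.inl (A.root w), by simp [IsMinor, A.own_root], by simp [branch, A.own_root, hw]⟩
  · have key : ∀ s t, black (own s) → ¬ (black (own t) ∧ t ≠ A.root (own t)) → A.Arc H s t →
        H.Adj (own s) (if black (own t) ∧ t = A.root (own t) then mate (own t) else own t) := by
      rintro s t hs ht (rfl | ⟨h1, h2, -⟩ | ⟨h1, -⟩ | ⟨-, h1, h2, -⟩ | ⟨h1, -⟩)
      · have : s = A.root (own s) := by tauto
        simpa [hs, ← this] using hmate (own s)
      · exact absurd ⟨h1, h2⟩ ht
      · exact absurd hs h1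
      · simpa [h1] using h2
      · exact absurd hs h1
    rintro (t | s) (t' | s') h h' ha
    · exact absurd ha (by simp [graph])
    · exact (key s' t (not_not.1 h') h ha).symm
    · exact key s t' (not_not.1 h) h' ha
    · exact absurd ha (by simp [graph])
  · have key : ∀ {v w}, H.Adj v w → black v → ∃ s t, black (own s) ∧
        ¬ black (own t) ∧ own s = v ∧ own t = w ∧ A.Arc H s t := by
      intro v w hvw hv
      obtain ⟨s, t, rfl, rfl, hR⟩ := harc hvw
      exact ⟨s, t, hv, (hcol hvw).1 hv, rfl, rfl,
        .inr (.inr (.inr (.inl ⟨hv, (hcol hvw).1 hv, hvw, hR⟩)))⟩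
    intro v w hvw
    by_cases hv : black v
    · obtain ⟨s, t, h1, h2, h3, h4, h5⟩ := key hvw hv
      exact ⟨.inr s, .inl t, by simpa [IsMinor] using h1, by simp [IsMinor, h2], h3,
        by simpa [branch, h2] using h4, h5⟩
    · obtain ⟨s, t, h1, h2, h3, h4, h5⟩ := key hvw.symm ((hcol hvw.symm).2 hv)
      exact ⟨.inl t, .inr s, by simp [IsMinor, h2], by simpa [IsMinor] using h1,
        by simpa [branch, h2] using h4, h3, h5⟩

end Arborescences

end StrongMinor

/-! ### A planar digraph with strongly connected tiles -/

/-- The digraph on `ℤ × ℤ` that arises from the infinite hexagonal grid, drawn with rows like the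
cylindrical matching grid, by contracting a perfect matching. Even rows are directed to the right and
odd rows to the left; every vertex has one more arc leaving it, to one of the two adjacent rows. -/
def HexArc (p q : ℤ × ℤ) : Prop :=
  (p.1 % 2 = 0 ∧ q.1 = p.1 ∧ q.2 = p.2 + 1) ∨ (p.1 % 2 = 1 ∧ q.1 = p.1 ∧ q.2 = p.2 - 1) ∨
  (p.1 % 2 = 0 ∧ p.2 % 2 = 0 ∧ q.1 = p.1 + 1 ∧ q.2 = p.2) ∨
  (p.1 % 2 = 1 ∧ p.2 % 2 = 0 ∧ q.1 = p.1 + 1 ∧ q.2 = p.2 + 1) ∨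
  (p.1 % 2 = 1 ∧ p.2 % 2 = 1 ∧ q.1 = p.1 - 1 ∧ q.2 = p.2 + 1) ∨
  (p.1 % 2 = 0 ∧ p.2 % 2 = 1 ∧ q.1 = p.1 - 1 ∧ q.2 = p.2)

instance (p q : ℤ × ℤ) : Decidable (HexArc p q) := by unfold HexArc; infer_instance

/-- The tile at position `c`: four rows, each of length six except for the first, which lacks its
last vertex, and each shifted by one against the row before. -/
def tile (c : ℤ × ℤ) : Set (ℤ × ℤ) :=
  {p | 4 * c.1 ≤ p.1 ∧ p.1 ≤ 4 * c.1 + 3 ∧ 2 ≤ p.1 - 4 * c.1 + (p.2 - 6 * c.2) ∧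
    p.1 - 4 * c.1 + (p.2 - 6 * c.2) ≤ 7 ∧ ¬ (p.1 = 4 * c.1 ∧ p.2 = 6 * c.2 + 7)}

/-- A closed directed walk that visits all vertices of the tile at the origin. -/
def tileWalk : List (ℤ × ℤ) :=
  [(0, 2), (0, 3), (0, 4), (0, 5), (0, 6), (1, 6), (1, 5), (1, 4), (1, 3), (1, 2), (2, 3), (2, 4),
   (3, 4), (3, 3), (3, 2), (3, 1), (3, 0), (3, -1), (2, 0), (2, 1), (2, 2), (2, 3), (2, 4), (2, 5),
   (1, 5), (1, 4), (1, 3), (1, 2), (1, 1), (0, 2)]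

theorem hexArc_translate {p q : ℤ × ℤ} (h : HexArc p q) (c : ℤ × ℤ) :
    HexArc (4 * c.1 + p.1, 6 * c.2 + p.2) (4 * c.1 + q.1, 6 * c.2 + q.2) := by
  rcases h with h | h | h | h | h | h
  · exact .inl (by simp only; omega)
  · exact .inr (.inl (by simp only; omega))
  · exact .inr (.inr (.inl (by simp only; omega)))
  · exact .inr (.inr (.inr (.inl (by simp only; omega))))
  · exact .inr (.inr (.inr (.inr (.inl (by simp only; omega)))))
  · exact .inr (.inr (.inr (.inr (.inr (by simp only; omega)))))

theorem tile_translate {p : ℤ × ℤ} (h : p ∈ tile (0, 0)) (c : ℤ × ℤ) :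
    (4 * c.1 + p.1, 6 * c.2 + p.2) ∈ tile c := by
  simp only [tile, Set.mem_ofPred_eq] at *
  omega

theorem exists_tileWalk_eq {c p : ℤ × ℤ} (h : p ∈ tile c) :
    ∃ i, ∃ hi : i < tileWalk.length,
      p = (4 * c.1 + (tileWalk[i]).1, 6 * c.2 + (tileWalk[i]).2) := by
  have key : ∀ a ∈ Finset.Icc (0 : ℤ) 3, ∀ b ∈ Finset.Icc (-1 : ℤ) 6, 2 ≤ a + b → a + b ≤ 7 →
      (a, b) ∈ tileWalk := by decide
  obtain ⟨h1, h2, h3, h4, h5⟩ := h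
  have := key (p.1 - 4 * c.1) (by simp; omega) (p.2 - 6 * c.2) (by simp; omega) (by omega)
    (by omega)
  obtain ⟨i, hi, h6⟩ := List.mem_iff_getElem.1 this
  refine ⟨i, hi, ?_⟩
  rw [h6]
  ext <;> simp

theorem stronglyConnectedOn_tile (c : ℤ × ℤ) : StronglyConnectedOn HexArc (tile c) := by
  have hmem : ∀ i, ∀ hi : i < tileWalk.length, tileWalk[i] ∈ tile (0, 0) := by
    have : ∀ p ∈ tileWalk, 0 ≤ p.1 ∧ p.1 ≤ 3 ∧ 2 ≤ p.1 + p.2 ∧ p.1 + p.2 ≤ 7 ∧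
      ¬ (p.1 = 0 ∧ p.2 = 7) := by decide
    intro i hi
    have := this _ (List.getElem_mem hi)
    simp only [tile, Set.mem_ofPred_eq]
    omega
  have hchain : tileWalk.IsChain HexArc := by decide
  let w : ∀ i, i < tileWalk.length → ℤ × ℤ := fun i hi =>
    (4 * c.1 + (tileWalk[i]).1, 6 * c.2 + (tileWalk[i]).2)
  have hreach : ∀ i j (hi : i < tileWalk.length) (hj : j < tileWalk.length), i ≤ j →
      Relation.ReflTransGen (StepIn HexArc (tile c)) (w i hi) (w j hj) := by
    intro i j hi hj hij
    induction j, hij using Nat.le_induction with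
    | base => exact .refl
    | succ j hij ih =>
      refine (ih (by omega)).tail ⟨tile_translate (hmem _ _) c, tile_translate (hmem _ _) c, ?_⟩
      exact hexArc_translate (List.isChain_iff_getElem.1 hchain j hj) c
  intro a ha b hb
  obtain ⟨i, hi, rfl⟩ := exists_tileWalk_eq ha
  obtain ⟨j, hj, rfl⟩ := exists_tileWalk_eq hb
  exact (hreach i 29 hi (by decide) (by simp [tileWalk] at hi; omega)).trans
    (hreach 0 j (by decide) hj (by omega))

theorem disjoint_tile {c d : ℤ × ℤ} (h : c ≠ d) : Disjoint (tile c) (tile d) := by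
  rw [Set.disjoint_left]
  intro p hc hd
  simp only [tile, Set.mem_ofPred_eq] at hc hd
  exact h (Prod.ext (by omega) (by omega))

/-- Adjacency in the square grid. -/
def GridAdj (c d : ℤ × ℤ) : Prop :=
  (c.1 = d.1 ∧ (c.2 = d.2 + 1 ∨ d.2 = c.2 + 1)) ∨ (c.2 = d.2 ∧ (c.1 = d.1 + 1 ∨ d.1 = c.1 + 1))

theorem GridAdj.symm {c d : ℤ × ℤ} (h : GridAdj c d) : GridAdj d c := by
  unfold GridAdj at *
  omega

theorem GridAdj.exists_hexArc {c d : ℤ × ℤ} (h : GridAdj c d) :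
    ∃ p ∈ tile c, ∃ q ∈ tile d, HexArc p q := by
  rcases c with ⟨I, J⟩
  rcases d with ⟨I', J'⟩
  rcases h with ⟨h1, h2 | h2⟩ | ⟨h1, h2 | h2⟩ <;> simp only at h1 h2 <;> subst h1 h2
  · refine ⟨(4 * I + 3, 6 * J' + 5), ?_, (4 * I + 3, 6 * J' + 4), ?_, ?_⟩ <;>
      simp [tile, HexArc] <;> omega
  · refine ⟨(4 * I + 2, 6 * J + 5), ?_, (4 * I + 2, 6 * J + 6), ?_, ?_⟩ <;>
      simp [tile, HexArc] <;> omega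
  · refine ⟨(4 * I' + 4, 6 * J + 3), ?_, (4 * I' + 3, 6 * J + 3), ?_, ?_⟩ <;>
      simp [tile, HexArc] <;> omega
  · refine ⟨(4 * I + 3, 6 * J + 2), ?_, (4 * I + 4, 6 * J + 3), ?_, ?_⟩ <;>
      simp [tile, HexArc] <;> omega

theorem stronglyConnectedOn_iUnion_tile {B : Set (ℤ × ℤ)} (hB : StronglyConnectedOn GridAdj B) :
    StronglyConnectedOn HexArc (⋃ c ∈ B, tile c) := by
  have hmono : ∀ {c}, c ∈ B → ∀ a ∈ tile c, ∀ b ∈ tile c,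
      Relation.ReflTransGen (StepIn HexArc (⋃ c ∈ B, tile c)) a b := by
    intro c hc a ha b hb
    refine Relation.ReflTransGen.mono ?_ _ _ (stronglyConnectedOn_tile c a ha b hb)
    exact fun x y h => ⟨Set.mem_biUnion hc h.1, Set.mem_biUnion hc h.2.1, h.2.2⟩
  intro a ha b hb
  simp only [Set.mem_iUnion, exists_prop] at ha hb
  obtain ⟨c, hc, ha⟩ := ha
  obtain ⟨d, hd, hb⟩ := hb
  induction hB c hc d hd generalizing b with
  | refl => exact hmono hc a ha b hb
  | tail _ hst ih =>
    obtain ⟨p, hp, q, hq, hpq⟩ := hst.2.2.exists_hexArc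
    exact ((ih p hst.1 hp).tail ⟨Set.mem_biUnion hst.1 hp, Set.mem_biUnion hst.2.1 hq, hpq⟩).trans
      (hmono hst.2.1 q hq b hb)

/-! ### Planar graphs as minors of the square grid -/

open Relation in
theorem ReflTransGen.stepIn_symm {B : Set (ℤ × ℤ)} {a b : ℤ × ℤ}
    (h : ReflTransGen (StepIn GridAdj B) a b) : ReflTransGen (StepIn GridAdj B) b a := by
  induction h with
  | refl => exact .refl
  | tail _ h ih => exact .head ⟨h.2.1, h.1, h.2.2.symm⟩ ih

open Relation in
/-- A discrete drawing of `H`, in which vertices are drawn as disjoint connected sets `Q v` and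
edges as connected sets `C e` that meet only in the sets `Q v`, contains `H` as a minor: the branch
set of a black vertex `v` consists of `Q v` and, for every edge `e` at `v`, the part of `C e` that is
reachable from `Q v` without entering any of the sets `Q w`. -/
theorem exists_gridModel_of_cells {V : Type*} {H : SimpleGraph V} {black : V → Prop}
    (hcol : ∀ {v w}, H.Adj v w → (black v ↔ ¬ black w))
    {Q : V → Set (ℤ × ℤ)} {C : H.edgeSet → Set (ℤ × ℤ)}
    (hQ : ∀ v, StronglyConnectedOn GridAdj (Q v)) (hC : ∀ e, StronglyConnectedOn GridAdj (C e))
    (hQQ : ∀ {u v c}, c ∈ Q u → c ∈ Q v → u = v)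
    (hCQ : ∀ {e : H.edgeSet} {v c}, c ∈ C e → c ∈ Q v → v ∈ (e : Sym2 V))
    (hCC : ∀ {e e' c}, c ∈ C e → c ∈ C e' → (∀ v, c ∉ Q v) → e = e')
    (hmeet : ∀ {e : H.edgeSet} {v}, v ∈ (e : Sym2 V) → (C e ∩ Q v).Nonempty) :
    ∃ B : V → Set (ℤ × ℤ), (∀ v, Q v ⊆ B v) ∧ (∀ v, B v ⊆ Q v ∪ ⋃ e, C e) ∧
      (∀ v, StronglyConnectedOn GridAdj (B v)) ∧ (∀ {u v c}, c ∈ B u → c ∈ B v → u = v) ∧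
      ∀ {u v}, H.Adj u v → ∃ c ∈ B u, ∃ d ∈ B v, GridAdj c d := by
  let Free : H.edgeSet → ℤ × ℤ → Prop := fun e c => c ∈ C e ∧ ∀ w, c ∉ Q w
  let P : H.edgeSet → V → Set (ℤ × ℤ) := fun e v =>
    {c | Free e c ∧ ∃ a ∈ Q v, ReflTransGen (fun x y => GridAdj x y ∧ Free e y) a c}
  let B : V → Set (ℤ × ℤ) := fun v =>
    {c | c ∈ Q v ∨ (black v ∧ ∃ e : H.edgeSet, v ∈ (e : Sym2 V) ∧ c ∈ P e v)}
  have hBB : ∀ {u v c}, c ∈ B u → c ∈ B v → u = v := by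
    rintro u v c (h | ⟨hu, e, hue, h⟩) (h' | ⟨hv, e', hve, h'⟩)
    · exact hQQ h h'
    · exact absurd h (h'.1.2 u)
    · exact absurd h' (h.1.2 v)
    · obtain rfl := hCC h.1.1 h'.1.1 h.1.2
      by_contra huv
      have he : (e : Sym2 V) = s(u, v) := (Sym2.mem_and_mem_iff huv).1 ⟨hue, hve⟩
      have hadj : H.Adj u v := by rw [← SimpleGraph.mem_edgeSet, ← he]; exact e.2
      exact (hcol hadj).1 hu hv
  have hpath : ∀ {v} {e : H.edgeSet} {a c}, black v → v ∈ (e : Sym2 V) → a ∈ Q v →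
      ReflTransGen (fun x y => GridAdj x y ∧ Free e y) a c →
      c ∈ B v ∧ ReflTransGen (StepIn GridAdj (B v)) a c := by
    intro v e a c hv hve ha h
    induction h with
    | refl => exact ⟨.inl ha, .refl⟩
    | tail h hst ih =>
      have hm : _ ∈ B v := .inr ⟨hv, e, hve, hst.2, a, ha, h.tail hst⟩
      exact ⟨hm, ih.2.tail ⟨ih.1, hm, hst.1⟩⟩
  have hQB : ∀ {v a b}, a ∈ Q v → b ∈ Q v → ReflTransGen (StepIn GridAdj (B v)) a b := by
    intro v a b ha hb
    refine ReflTransGen.mono ?_ _ _ (hQ v a ha b hb)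
    exact fun x y h => ⟨.inl h.1, .inl h.2.1, h.2.2⟩
  have hbase : ∀ {v c}, c ∈ B v → ∃ a ∈ Q v, ReflTransGen (StepIn GridAdj (B v)) a c := by
    rintro v c (h | ⟨hv, e, hve, -, a, ha, h⟩)
    · exact ⟨c, h, .refl⟩
    · exact ⟨a, ha, (hpath hv hve ha h).2⟩
  have hadj : ∀ {u v}, H.Adj u v → black u → ∃ c ∈ B u, ∃ d ∈ B v, GridAdj c d := by
    intro u v huv hu
    let e : H.edgeSet := ⟨s(u, v), huv⟩
    have hue : u ∈ (e : Sym2 V) := Sym2.mem_mk_left u v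
    obtain ⟨a, ha, hau⟩ := hmeet hue
    obtain ⟨z, hz, hzv⟩ := hmeet (e := e) (Sym2.mem_mk_right u v)
    -- Follow a path in `C e` from `Q u` to `Q v` until it enters `Q v`.
    have key : ∀ c, ReflTransGen (StepIn GridAdj (C e)) a c →
        (∃ c ∈ B u, ∃ d ∈ B v, GridAdj c d) ∨ c ∈ B u := by
      intro c h
      induction h with
      | refl => exact .inr (.inl hau)
      | @tail c c' h hst ih =>
        rcases ih with ih | ih
        · exact .inl ih
        by_cases hex : ∃ w, c' ∈ Q w
        · obtain ⟨w, hw⟩ := hex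
          rcases Sym2.mem_iff.1 (hCQ hst.2.1 hw) with rfl | rfl
          · exact .inr (.inl hw)
          · exact .inl ⟨c, ih, c', .inl hw, hst.2.2⟩
        · have hfree : Free e c' := ⟨hst.2.1, fun w hw => hex ⟨w, hw⟩⟩
          refine .inr (.inr ⟨hu, e, hue, hfree, ?_⟩)
          rcases ih with ih | ⟨-, e', -, ih, b, hb, hbc⟩
          · exact ⟨c, ih, .single ⟨hst.2.2, hfree⟩⟩
          · obtain rfl := hCC ih.1 hst.1 ih.2
            exact ⟨b, hb, hbc.tail ⟨hst.2.2, hfree⟩⟩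
    rcases key z (hC e a ha z hz) with h | h
    · exact h
    · exact absurd (hBB h (.inl hzv)) huv.ne
  refine ⟨B, fun v c h => .inl h, ?_, ?_, hBB, ?_⟩
  · rintro v c (h | ⟨-, e, -, h⟩)
    · exact .inl h
    · exact .inr (Set.mem_iUnion.2 ⟨e, h.1.1⟩)
  · intro v c hc d hd
    obtain ⟨a, ha, hac⟩ := hbase hc
    obtain ⟨b, hb, hbd⟩ := hbase hd
    exact (ReflTransGen.stepIn_symm hac).trans ((hQB ha hb).trans hbd)
  · intro u v huv
    by_cases hu : black u
    · exact hadj huv hu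
    · obtain ⟨c, hc, d, hd, h⟩ := hadj huv.symm ((hcol huv.symm).2 hu)
      exact ⟨d, hd, c, hc, h.symm⟩

/-- The points of the integer grid at distance less than one from `n • s`. -/
def near (n : ℝ) (s : ℝ × ℝ) : Set (ℤ × ℤ) :=
  {c | |(c.1 : ℝ) - n * s.1| < 1 ∧ |(c.2 : ℝ) - n * s.2| < 1}

/-- The points of the integer grid at distance less than one from `n • S`. -/
def cells (n : ℝ) (S : Set (ℝ × ℝ)) : Set (ℤ × ℤ) := {c | ∃ s ∈ S, c ∈ near n s}

theorem floor_mem_near (n : ℝ) (s : ℝ × ℝ) : (⌊n * s.1⌋, ⌊n * s.2⌋) ∈ near n s := by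
  have h1 := Int.floor_le (n * s.1)
  have h2 := Int.lt_floor_add_one (n * s.1)
  have h3 := Int.floor_le (n * s.2)
  have h4 := Int.lt_floor_add_one (n * s.2)
  constructor <;> simp only [abs_lt] <;> constructor <;> linarith

open Relation in
theorem stronglyConnectedOn_near (n : ℝ) (s : ℝ × ℝ) : StronglyConnectedOn GridAdj (near n s) := by
  have key : ∀ {a b : ℤ} {x : ℝ}, |(a : ℝ) - x| < 1 → |(b : ℝ) - x| < 1 →
      a = b ∨ a = b + 1 ∨ b = a + 1 := by
    intro a b x ha hb
    rw [abs_lt] at ha hb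
    have h1 : (a : ℝ) < b + 2 := by linarith
    have h2 : (b : ℝ) < a + 2 := by linarith
    have h3 : a < b + 2 := by exact_mod_cast h1
    have h4 : b < a + 2 := by exact_mod_cast h2
    omega
  rintro ⟨a, b⟩ h ⟨a', b'⟩ h'
  have hm : (a', b) ∈ near n s := ⟨h'.1, h.2⟩
  have h1 : ReflTransGen (StepIn GridAdj (near n s)) (a, b) (a', b) := by
    rcases key h.1 h'.1 with h0 | h0
    · simp only at h0; rw [h0]
    · exact .single ⟨h, hm, .inr ⟨rfl, h0⟩⟩
  have h2 : ReflTransGen (StepIn GridAdj (near n s)) (a', b) (a', b') := by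
    rcases key h.2 h'.2 with h0 | h0
    · simp only at h0; rw [h0]
    · exact .single ⟨hm, h', .inl ⟨rfl, h0⟩⟩
  exact h1.trans h2

open Relation in
theorem stronglyConnectedOn_cells (n : ℝ) {S : Set (ℝ × ℝ)} (hS : IsPreconnected S) :
    StronglyConnectedOn GridAdj (cells n S) := by
  have hnear : ∀ {s}, s ∈ S → ∀ c ∈ near n s, ∀ d ∈ near n s,
      ReflTransGen (StepIn GridAdj (cells n S)) c d := by
    intro s hs c hc d hd
    refine ReflTransGen.mono ?_ _ _ (stronglyConnectedOn_near n s c hc d hd)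
    exact fun x y h => ⟨⟨s, hs, h.1⟩, ⟨s, hs, h.2.1⟩, h.2.2⟩
  rintro c ⟨s, hs, hc⟩ d ⟨t, ht, hd⟩
  refine hS.induction₂ (fun s t => ∀ c ∈ near n s, ∀ d ∈ near n t,
    ReflTransGen (StepIn GridAdj (cells n S)) c d) ?_ ?_ ?_ hs ht c hc d hd
  · intro s hs
    have hf := floor_mem_near n s
    have hev : ∀ᶠ t in nhdsWithin s S, (⌊n * s.1⌋, ⌊n * s.2⌋) ∈ near n t := by
      refine Filter.Eventually.filter_mono nhdsWithin_le_nhds (IsOpen.mem_nhds ?_ hf)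
      have h (a : ℤ) (f : ℝ × ℝ → ℝ) (hf : Continuous f) : IsOpen {t | |(a : ℝ) - n * f t| < 1} :=
        isOpen_lt (by fun_prop) continuous_const
      exact (h _ _ continuous_fst).inter (h _ _ continuous_snd)
    filter_upwards [hev, self_mem_nhdsWithin] with t ht htS c hc d hd
    exact (hnear hs c hc _ hf).trans (hnear htS _ ht d hd)
  · intro x y z _ _ _ hxy hyz c hc d hd
    exact (hxy c hc _ (floor_mem_near n y)).trans (hyz _ (floor_mem_near n y) d hd)
  · intro x y _ _ hxy c hc d hd
    exact ReflTransGen.stepIn_symm (hxy d hd c hc)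

theorem cells_finite (n : ℝ) {S : Set (ℝ × ℝ)} (hS : IsCompact S) : (cells n S).Finite := by
  have h1 : Bornology.IsBounded ((fun s : ℝ × ℝ => n * s.1) '' S) :=
    (hS.image (by fun_prop)).isBounded
  have h2 : Bornology.IsBounded ((fun s : ℝ × ℝ => n * s.2) '' S) :=
    (hS.image (by fun_prop)).isBounded
  obtain ⟨R1, hR1⟩ := h1.exists_norm_le
  obtain ⟨R2, hR2⟩ := h2.exists_norm_le
  refine ((Set.finite_Icc (-⌈R1 + 1⌉) ⌈R1 + 1⌉).prod (Set.finite_Icc (-⌈R2 + 1⌉) ⌈R2 + 1⌉)).subset ?_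
  have key : ∀ {a : ℤ} {x R : ℝ}, |(a : ℝ) - x| < 1 → ‖x‖ ≤ R → a ∈ Set.Icc (-⌈R + 1⌉) ⌈R + 1⌉ := by
    intro a x R ha hx
    rw [Real.norm_eq_abs, abs_le] at hx
    rw [abs_lt] at ha
    have h := Int.le_ceil (R + 1)
    have h3 : (a : ℝ) ≤ ⌈R + 1⌉ := by linarith
    have h4 : ((-⌈R + 1⌉ : ℤ) : ℝ) ≤ a := by push_cast; linarith
    exact ⟨by exact_mod_cast h4, by exact_mod_cast h3⟩
  rintro c ⟨s, hs, hc⟩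
  exact ⟨key hc.1 (hR1 _ ⟨s, hs, rfl⟩), key hc.2 (hR2 _ ⟨s, hs, rfl⟩)⟩

theorem dist_lt_of_mem_near {n : ℝ} (hn : 0 < n) {s t : ℝ × ℝ} {c : ℤ × ℤ} (hs : c ∈ near n s)
    (ht : c ∈ near n t) : dist s t < 2 / n := by
  have key : ∀ {a x y : ℝ}, |a - n * x| < 1 → |a - n * y| < 1 → dist x y < 2 / n := by
    intro a x y hx hy
    rw [abs_lt] at hx hy
    rw [Real.dist_eq, lt_div_iff₀ hn, ← abs_of_pos hn, ← abs_mul, abs_lt]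
    constructor <;> nlinarith
  rw [Prod.dist_eq]
  exact max_lt (key hs.1 ht.1) (key hs.2 ht.2)

open Filter Topology in
/-- A planar bipartite graph is a minor of the square grid: the parts of the arcs of a drawing
outside small balls around the vertices have positive distance from each other, so that a
sufficiently fine grid separates them. -/
theorem IsPlanar.exists_gridModel {V : Type*} [Finite V] {H : SimpleGraph V} (hp : IsPlanar H)
    {black : V → Prop} (hcol : ∀ {v w}, H.Adj v w → (black v ↔ ¬ black w)) :
    ∃ B : V → Set (ℤ × ℤ), (∀ v, (B v).Nonempty) ∧ (∀ v, (B v).Finite) ∧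
      (∀ v, StronglyConnectedOn GridAdj (B v)) ∧ (∀ {u v c}, c ∈ B u → c ∈ B v → u = v) ∧
      ∀ {u v}, H.Adj u v → ∃ c ∈ B u, ∃ d ∈ B v, GridAdj c d := by
  obtain ⟨p, arc, hinj, hcont, -, hends, hint, hdis⟩ := hp
  have hend : ∀ (e : H.edgeSet) t, t ∈ Set.Ioo (0 : unitInterval) 1 ∨
      ∃ v ∈ (e : Sym2 V), arc e t = p v := by
    intro e t
    have hmem : ∀ x, x ∈ s(arc e 0, arc e 1) → ∃ v ∈ (e : Sym2 V), x = p v := by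
      intro x hx
      rw [hends e, Sym2.mem_map] at hx
      obtain ⟨v, hv, rfl⟩ := hx
      exact ⟨v, hv, rfl⟩
    rcases eq_or_ne t 0 with rfl | h0
    · exact .inr (hmem _ (Sym2.mem_mk_left _ _))
    rcases eq_or_ne t 1 with rfl | h1
    · exact .inr (hmem _ (Sym2.mem_mk_right _ _))
    · exact .inl ⟨unitInterval.pos_iff_ne_zero.2 h0, unitInterval.lt_one_iff_ne_one.2 h1⟩
  have hinc : ∀ (e : H.edgeSet) v, v ∈ (e : Sym2 V) → ∃ t, arc e t = p v := by
    intro e v hv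
    have : p v ∈ s(arc e 0, arc e 1) := by
      rw [hends e, Sym2.mem_map]
      exact ⟨v, hv, rfl⟩
    rcases Sym2.mem_iff.1 this with h | h
    · exact ⟨0, h.symm⟩
    · exact ⟨1, h.symm⟩
  have hsmall : ∀ {a : ℝ}, 0 < a → ∀ᶠ r in 𝓝[>] (0 : ℝ), 3 * r ≤ a := by
    intro a ha
    filter_upwards [Ioo_mem_nhdsGT (show (0 : ℝ) < a / 3 by positivity)] with r hr
    linarith [hr.2]
  have hr1 : ∀ᶠ r in 𝓝[>] (0 : ℝ), ∀ u v, u ≠ v → 3 * r ≤ dist (p u) (p v) := by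
    simp only [eventually_all]
    intro u v huv
    exact hsmall (dist_pos.2 fun h => huv (hinj h))
  have hr2 : ∀ᶠ r in 𝓝[>] (0 : ℝ), ∀ (e : H.edgeSet) v, v ∉ (e : Sym2 V) →
      ∀ t, 3 * r ≤ dist (p v) (arc e t) := by
    rw [eventually_all]; intro e
    rw [eventually_all]; intro v
    rw [eventually_all]; intro hv
    obtain ⟨a, ha, h⟩ := isCompact_univ.exists_forall_le' (f := fun t => dist (p v) (arc e t))
      (continuous_const.dist (hcont e)).continuousOn (a := 0) (by
        intro t _
        refine dist_pos.2 fun h => ?_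
        rcases hend e t with h1 | ⟨w, hw, h1⟩
        · exact hint e t h1 ⟨v, h⟩
        · exact hv (hinj (h.trans h1) ▸ hw))
    filter_upwards [hsmall ha] with r hr t
    exact hr.trans (h t trivial)
  obtain ⟨r, ⟨hr1, hr2⟩, hr⟩ := ((hr1.and hr2).and self_mem_nhdsWithin).exists
  replace hr : 0 < r := hr
  -- The parts of the arcs outside the open balls of radius `r` are disjoint compact sets.
  let T : H.edgeSet → Set unitInterval := fun e => {t | ∀ v, r ≤ dist (arc e t) (p v)}
  have hT : ∀ e, IsCompact (T e) := by
    intro e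
    refine IsClosed.isCompact ?_
    simp only [T, Set.ofPred_forall]
    exact isClosed_iInter fun v => isClosed_le continuous_const ((hcont e).dist continuous_const)
  have hTio : ∀ {e t}, t ∈ T e → t ∈ Set.Ioo (0 : unitInterval) 1 := by
    intro e t ht
    rcases hend e t with h | ⟨v, -, h⟩
    · exact h
    · have := ht v
      rw [h, dist_self] at this
      exact absurd hr this.not_gt
  have hr3 : ∀ᶠ ε in 𝓝[>] (0 : ℝ), ∀ e e', e ≠ e' → ∀ t ∈ T e, ∀ t' ∈ T e',
      3 * ε ≤ dist (arc e t) (arc e' t') := by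
    rw [eventually_all]; intro e
    rw [eventually_all]; intro e'
    rw [eventually_all]; intro hne
    have hc : Continuous fun x : unitInterval × unitInterval => dist (arc e x.1) (arc e' x.2) :=
      ((hcont e).comp continuous_fst).dist ((hcont e').comp continuous_snd)
    obtain ⟨a, ha, h⟩ := ((hT e).prod (hT e')).exists_forall_le' hc.continuousOn (a := 0)
      fun x hx => dist_pos.2 (hdis e e' hne _ (hTio hx.1) _ (hTio hx.2))
    filter_upwards [hsmall ha] with ε hε t ht t' ht'
    exact hε.trans (h (t, t') ⟨ht, ht'⟩)
  obtain ⟨ε, ⟨hr3, hεr⟩, hε⟩ := ((hr3.and (hsmall hr)).and self_mem_nhdsWithin).exists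
  replace hε : 0 < ε := hε
  -- In the grid scaled by `2 / ε`, a grid point is only near points at distance less than `ε`.
  have hn : 0 < 2 / ε := by positivity
  have hdist : ∀ {s t c}, c ∈ near (2 / ε) s → c ∈ near (2 / ε) t → dist s t < ε := by
    intro s t c hs ht
    have := dist_lt_of_mem_near hn hs ht
    rwa [div_div_cancel₀ two_ne_zero] at this
  let Q : V → Set (ℤ × ℤ) := fun v => cells (2 / ε) (Metric.closedBall (p v) r)
  let C : H.edgeSet → Set (ℤ × ℤ) := fun e => cells (2 / ε) (Set.range (arc e))
  have hCc : ∀ e, IsCompact (Set.range (arc e)) := fun e => isCompact_range (hcont e)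
  obtain ⟨B, h1, h2, h3, h4, h5⟩ := exists_gridModel_of_cells hcol (Q := Q) (C := C)
    (fun v => stronglyConnectedOn_cells _ (convex_closedBall _ _).isPreconnected)
    (fun e => stronglyConnectedOn_cells _ (isPreconnected_range (hcont e)))
    (by
      rintro u v c ⟨s, hs, hcs⟩ ⟨t, ht, hct⟩
      by_contra huv
      have h6 := hr1 u v huv
      have h7 := hdist hcs hct
      have h8 := dist_triangle4 (p u) s t (p v)
      rw [Metric.mem_closedBall] at hs ht
      rw [dist_comm (p u) s] at h8
      linarith)
    (by
      rintro e v c ⟨_, ⟨t, rfl⟩, hct⟩ ⟨s, hs, hcs⟩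
      by_contra hv
      have h6 := hr2 e v hv t
      have h7 := hdist hcs hct
      have h8 := dist_triangle_left (p v) (arc e t) s
      rw [Metric.mem_closedBall] at hs
      linarith)
    (by
      rintro e e' c ⟨_, ⟨t, rfl⟩, ht⟩ ⟨_, ⟨t', rfl⟩, ht'⟩ hc
      by_contra hne
      have hmem : ∀ {e t}, c ∈ near (2 / ε) (arc e t) → t ∈ T e := by
        intro e t h v
        by_contra h6
        exact hc v ⟨arc e t, Metric.mem_closedBall.2 (not_le.1 h6).le, h⟩
      have h6 := hr3 e e' hne t (hmem ht) t' (hmem ht')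
      have h7 := hdist ht ht'
      linarith)
    (by
      intro e v hv
      obtain ⟨t, ht⟩ := hinc e v hv
      exact ⟨_, ⟨arc e t, ⟨t, rfl⟩, floor_mem_near _ _⟩,
        ⟨p v, Metric.mem_closedBall_self hr.le, ht ▸ floor_mem_near _ _⟩⟩)
  refine ⟨B, fun v => ⟨_, h1 v ⟨p v, Metric.mem_closedBall_self hr.le, floor_mem_near _ _⟩⟩,
    fun v => Set.Finite.subset ?_ (h2 v), h3, h4, h5⟩
  exact (cells_finite _ (isCompact_closedBall _ _)).union
    (Set.finite_iUnion fun e => cells_finite _ (hCc e))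

/-! ### Embedding into the cylindrical matching grid -/

theorem hasPerfectMatching_of_involution {U : Type*} {G : SimpleGraph U} (m : U → U)
    (hm : ∀ u, m (m u) = u) (hadj : ∀ u, G.Adj u (m u)) : HasPerfectMatching G := by
  refine ⟨{ verts := Set.univ, Adj := fun u v => m u = v, adj_sub := ?_, edge_vert := ?_,
            symm := ⟨?_⟩ }, ?_⟩
  · rintro u _ rfl
    exact hadj u
  · exact fun _ => trivial
  · rintro u _ rfl
    exact hm u
  · exact SimpleGraph.Subgraph.isPerfectMatching_iff.2 fun u => ⟨m u, rfl, fun _ h => Eq.symm h⟩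

theorem grid_adj_succ {k : ℕ} {p q : Fin k × Fin (4 * k)} (h1 : (p.1 : ℕ) = q.1)
    (h2 : (q.2 : ℕ) = p.2 + 1) : (cylindricalMatchingGrid k).Adj p q := by
  refine (SimpleGraph.fromRel_adj _ _ _).2 ⟨?_, .inl (.inl ⟨Fin.ext h1, ?_⟩)⟩
  · rintro rfl; omega
  · rw [Nat.mod_eq_of_lt (h2 ▸ q.2.2), h2]

theorem grid_adj_last {k : ℕ} {p q : Fin k × Fin (4 * k)} (h1 : (p.1 : ℕ) = q.1)
    (h2 : (p.2 : ℕ) + 1 = 4 * k) (h3 : (q.2 : ℕ) = 0) : (cylindricalMatchingGrid k).Adj p q := by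
  refine (SimpleGraph.fromRel_adj _ _ _).2 ⟨?_, .inl (.inl ⟨Fin.ext h1, ?_⟩)⟩
  · rintro rfl; omega
  · rw [h2, Nat.mod_self, h3]

theorem grid_adj_up {k : ℕ} {p q : Fin k × Fin (4 * k)} (h1 : (q.1 : ℕ) = p.1 + 1)
    (h2 : (p.2 : ℕ) % 4 = 0) (h3 : (q.2 : ℕ) = p.2 + 1) :
    (cylindricalMatchingGrid k).Adj p q := by
  refine (SimpleGraph.fromRel_adj _ _ _).2 ⟨?_, .inl (.inr (.inl ⟨h1, h2, h3⟩))⟩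
  rintro rfl; omega

theorem grid_adj_down {k : ℕ} {p q : Fin k × Fin (4 * k)} (h1 : (p.1 : ℕ) = q.1 + 1)
    (h2 : (p.2 : ℕ) % 4 = 2) (h3 : (q.2 : ℕ) = p.2 + 1) :
    (cylindricalMatchingGrid k).Adj p q := by
  refine (SimpleGraph.fromRel_adj _ _ _).2 ⟨?_, .inl (.inr (.inr ⟨h1, h2, h3⟩))⟩
  rintro rfl; omega

/-- The column of the partner of the vertex `(i, j)` in the perfect matching of the cylindrical
matching grid that is contracted to obtain `HexArc`. With indices starting at `0`, vertices in even
columns are matched to the right in odd rows, and to the left, cyclically, in even rows. -/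
def partnerCol (k i j : ℕ) : ℕ :=
  if i % 2 = 1 then if j % 2 = 0 then j + 1 else j - 1
  else if j % 2 = 0 then if j = 0 then 4 * k - 1 else j - 1
  else if j + 1 = 4 * k then 0 else j + 1

theorem partnerCol_cases {k i j : ℕ} (h : j < 4 * k) :
    (partnerCol k i j = j + 1 ∧ j + 1 < 4 * k ∧ i % 2 ≠ j % 2) ∨
    (j = partnerCol k i j + 1 ∧ i % 2 = j % 2) ∨
    (partnerCol k i j = 0 ∧ j + 1 = 4 * k ∧ i % 2 = 0) ∨
    (partnerCol k i j + 1 = 4 * k ∧ j = 0 ∧ i % 2 = 0) := by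
  unfold partnerCol
  split_ifs <;> omega

theorem partnerCol_lt {k i j : ℕ} (h : j < 4 * k) : partnerCol k i j < 4 * k := by
  have := partnerCol_cases (i := i) h
  omega

/-- The partner of a vertex in the perfect matching described at `partnerCol`. -/
def partner {k : ℕ} (u : Fin k × Fin (4 * k)) : Fin k × Fin (4 * k) :=
  (u.1, ⟨partnerCol k u.1 u.2, partnerCol_lt u.2.2⟩)

theorem partner_partner {k : ℕ} (u : Fin k × Fin (4 * k)) : partner (partner u) = u := by
  have h : partnerCol k u.1 (partnerCol k u.1 u.2) = u.2 := by
    have h1 := partnerCol_cases (i := u.1) u.2.2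
    have h2 := partnerCol_cases (i := u.1) (partnerCol_lt (i := u.1) u.2.2)
    omega
  exact Prod.ext rfl (Fin.ext h)

theorem adj_partner {k : ℕ} (u : Fin k × Fin (4 * k)) :
    (cylindricalMatchingGrid k).Adj u (partner u) := by
  rcases partnerCol_cases (i := u.1) u.2.2 with h | h | h | h
  · exact grid_adj_succ rfl h.1
  · exact (grid_adj_succ (p := partner u) (q := u) rfl h.1).symm
  · exact grid_adj_last rfl h.2.1 h.1
  · exact (grid_adj_last (p := partner u) (q := u) rfl h.1 h.2.1).symm

/-- Disjoint finite connected sets in the square grid, one for each vertex of a bipartite graph `H`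
with a perfect matching and adjacent for adjacent vertices of `H`, yield `H` as a matching minor of a
cylindrical matching grid: the tiles at the positions in these sets are strongly connected, so
they contain the arborescences from which `H` is obtained. -/
theorem isMatchingMinor_of_gridModel {V : Type*} [Finite V] {H : SimpleGraph V} {black : V → Prop}
    (hcol : ∀ {v w}, H.Adj v w → (black v ↔ ¬ black w)) (hpm : HasPerfectMatching H)
    {B : V → Set (ℤ × ℤ)} (hfin : ∀ v, (B v).Finite)
    (hsc : ∀ v, StronglyConnectedOn GridAdj (B v)) (hdis : ∀ {u v c}, c ∈ B u → c ∈ B v → u = v)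
    (hB : ∀ {u v}, H.Adj u v → ∃ c ∈ B u, ∃ d ∈ B v, GridAdj c d) :
    ∃ k, IsMatchingMinor H (cylindricalMatchingGrid k) := by
  classical
  -- A perfect matching of `H` as an involution.
  obtain ⟨M, hM⟩ := hpm
  choose mate hmate hmate' using SimpleGraph.Subgraph.isPerfectMatching_iff.1 hM
  have hadj : ∀ w, H.Adj w (mate w) := fun w => M.adj_sub (hmate w)
  have hinv : ∀ w, mate (mate w) = w := fun w => (hmate' _ _ (hmate w).symm).symm
  have hmb : ∀ {w}, ¬ black w → black (mate w) := fun {w} => (hcol (hadj w).symm).2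
  -- The vertices of the digraph in the tiles of the model, and the branch sets containing them.
  let X := {p : ℤ × ℤ // ∃ v, p ∈ ⋃ c ∈ B v, tile c}
  let own : X → V := fun p => p.2.choose
  have hown : ∀ {p : X} {v}, p.1 ∈ (⋃ c ∈ B v, tile c) ↔ own p = v := by
    intro p v
    have hp : p.1 ∈ ⋃ c ∈ B (own p), tile c := p.2.choose_spec
    refine ⟨fun h => ?_, fun h => h ▸ hp⟩
    simp only [Set.mem_iUnion, exists_prop] at h hp
    obtain ⟨c, hc, hpc⟩ := h
    obtain ⟨d, hd, hpd⟩ := hp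
    by_cases hcd : c = d
    · exact hdis hd (hcd ▸ hc)
    · exact absurd hpd (Set.disjoint_left.1 (disjoint_tile hcd) hpc)
  let R : X → X → Prop := fun s t => HexArc s.1 t.1
  have hsc' : ∀ w, StronglyConnectedOn R {t | own t = w} := by
    intro w a ha b hb
    have key : ∀ b, Relation.ReflTransGen (StepIn HexArc (⋃ c ∈ B w, tile c)) a.1 b →
        ∀ hb : ∃ v, b ∈ ⋃ c ∈ B v, tile c,
          Relation.ReflTransGen (StepIn R {t | own t = w}) a ⟨b, hb⟩ := by
      intro b h
      induction h with
      | refl => exact fun _ => .refl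
      | tail _ hst ih =>
        exact fun _ => (ih ⟨w, hst.1⟩).tail ⟨hown.1 hst.1, hown.1 hst.2.1, hst.2.2⟩
    exact key b.1 (stronglyConnectedOn_iUnion_tile (hsc w) _ (hown.2 ha) _ (hown.2 hb)) b.2
  have harc : ∀ {v w}, H.Adj v w → ∃ s t : X, own s = v ∧ own t = w ∧ R s t := by
    intro v w hvw
    obtain ⟨c, hc, d, hd, hcd⟩ := hB hvw
    obtain ⟨p, hp, q, hq, hpq⟩ := hcd.exists_hexArc
    have hp' := Set.mem_biUnion hc hp
    have hq' := Set.mem_biUnion hd hq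
    exact ⟨⟨p, v, hp'⟩, ⟨q, w, hq'⟩, hown.1 hp', hown.1 hq', hpq⟩
  obtain ⟨A⟩ := exists_arborescences hcol hadj hinv hsc' harc
  obtain ⟨T⟩ := A.nonempty_treeModel hcol hadj hinv harc
  -- All positions lie in a square of side `2 * N` around the origin, which is moved into the grid.
  obtain ⟨N, hN⟩ : ∃ N : ℕ, ∀ v, ∀ c ∈ B v, |c.1| < N ∧ |c.2| < N := by
    obtain ⟨n, hn⟩ := ((Set.finite_iUnion hfin).image fun c => max |c.1| |c.2|).bddAbove
    refine ⟨n.toNat + 1, fun v c hc => ?_⟩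
    have h := hn ⟨c, Set.mem_iUnion.2 ⟨v, hc⟩, rfl⟩
    have h1 := (le_max_left _ _).trans h
    have h2 := (le_max_right _ _).trans h
    omega
  let k := 16 * (N + 1)
  have hbound : ∀ p : X, 0 ≤ p.1.1 + 4 * N ∧ p.1.1 + 4 * N < k ∧ 1 ≤ 2 * (p.1.2 + 6 * N) ∧
      2 * (p.1.2 + 6 * N) + 1 < 4 * k := by
    rintro ⟨p, v, hp⟩
    simp only [Set.mem_iUnion, exists_prop] at hp
    obtain ⟨c, hc, hp⟩ := hp
    obtain ⟨h1, h2⟩ := hN v c hc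
    rw [abs_lt] at h1 h2
    simp only [tile, Set.mem_ofPred_eq] at hp
    simp only [k]
    omega
  have hex : ∀ a : X ⊕ X, ∃ u : Fin k × Fin (4 * k),
      ((u.1 : ℕ) : ℤ) = (Sum.elim id id a).1.1 + 4 * N ∧
      ((u.2 : ℕ) : ℤ) = 2 * ((Sum.elim id id a).1.2 + 6 * N) +
        Sum.elim (fun p => if p.1.1 % 2 = 0 then -1 else 1) (fun _ => 0) a := by
    have key : ∀ x y : ℤ, 0 ≤ x → x < k → 0 ≤ y → y < 4 * k →
        ∃ u : Fin k × Fin (4 * k), ((u.1 : ℕ) : ℤ) = x ∧ ((u.2 : ℕ) : ℤ) = y := by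
      intro x y h1 h2 h3 h4
      exact ⟨(⟨x.toNat, by omega⟩, ⟨y.toNat, by omega⟩), by simp [h1], by simp [h3]⟩
    rintro (p | p)
    · have := hbound p
      refine key _ _ this.1 this.2.1 ?_ ?_ <;> simp only [Sum.elim_inl, id] <;> split_ifs <;> omega
    · have := hbound p
      refine key _ _ this.1 this.2.1 ?_ ?_ <;> simp only [Sum.elim_inr, id] <;> omega
  choose j hj1 hj2 using hex
  have hswap : ∀ a, partner (j a) = j a.swap := by
    have key : ∀ a, partnerCol k (j a).1 (j a).2 = (j a.swap).2 := by
      rintro (p | p)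
      · have h0 := hbound p
        have h1 := hj1 (.inl p)
        have h2 := hj2 (.inl p)
        have h3 := hj2 (.inr p)
        simp only [Sum.elim_inl, Sum.elim_inr, id] at h1 h2 h3
        simp only [Sum.swap_inl, partnerCol]
        split_ifs at h2 ⊢ <;> omega
      · have h0 := hbound p
        have h1 := hj1 (.inr p)
        have h2 := hj2 (.inl p)
        have h3 := hj2 (.inr p)
        simp only [Sum.elim_inl, Sum.elim_inr, id] at h1 h2 h3
        simp only [Sum.swap_inr, partnerCol]
        split_ifs at h2 ⊢ <;> omega
    intro a
    refine Prod.ext (Fin.ext ?_) (Fin.ext (key a))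
    have h1 := hj1 a
    have h2 := hj1 a.swap
    have h3 : (Sum.elim id id a.swap : X) = Sum.elim id id a := by cases a <;> rfl
    rw [h3] at h2
    exact_mod_cast h1.trans h2.symm
  have hinj : Function.Injective j := by
    intro a b hab
    have h1 := hj1 a
    have h2 := hj2 a
    have h3 := hj1 b
    have h4 := hj2 b
    rw [hab] at h1 h2
    rcases a with p | p <;> rcases b with q | q <;>
      simp only [Sum.elim_inl, Sum.elim_inr, id] at h1 h2 h3 h4
    · refine congrArg Sum.inl (Subtype.ext (Prod.ext (by omega) ?_))
      split_ifs at h2 h4 <;> omega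
    · split_ifs at h2 <;> omega
    · split_ifs at h4 <;> omega
    · exact congrArg Sum.inr (Subtype.ext (Prod.ext (by omega) (by omega)))
  have hhom : ∀ s t, s = t ∨ R s t → (cylindricalMatchingGrid k).Adj (j (.inr s)) (j (.inl t)) := by
    rintro s t (rfl | h)
    · have := adj_partner (j (.inr s))
      rwa [hswap] at this
    · have h1 := hj1 (.inr s)
      have h2 := hj2 (.inr s)
      have h3 := hj1 (.inl t)
      have h4 := hj2 (.inl t)
      simp only [Sum.elim_inl, Sum.elim_inr, id] at h1 h2 h3 h4
      rcases h with h | h | h | h | h | h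
      · rw [if_pos (by omega)] at h4
        exact grid_adj_succ (by omega) (by omega)
      · rw [if_neg (by omega)] at h4
        exact (grid_adj_succ (by omega) (by omega)).symm
      · rw [if_neg (by omega)] at h4
        exact grid_adj_up (by omega) (by omega) (by omega)
      · rw [if_pos (by omega)] at h4
        exact grid_adj_up (by omega) (by omega) (by omega)
      · rw [if_pos (by omega)] at h4
        exact grid_adj_down (by omega) (by omega) (by omega)
      · rw [if_neg (by omega)] at h4
        exact grid_adj_down (by omega) (by omega) (by omega)
  have hArc : ∀ {s t}, A.Arc H s t → s = t ∨ R s t := fun h =>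
    Arborescences.Arc.eq_or_rel (A := A) hmb hinv h
  let f : SimpleGraph.Copy (A.graph H) (cylindricalMatchingGrid k) :=
    ⟨⟨j, by
      rintro (a | a) (b | b) h
      · exact False.elim h
      · exact (hhom b a (hArc h)).symm
      · exact hhom a b (hArc h)
      · exact False.elim h⟩, hinj⟩
  have hverts : f.toSubgraph.verts = Set.range j := by
    simp [f, SimpleGraph.Copy.toSubgraph]
  have hcompl : ∀ u : (f.toSubgraph.vertsᶜ : Set _), partner u.1 ∈ f.toSubgraph.vertsᶜ := by
    rintro ⟨u, hu⟩ h
    obtain ⟨a, ha⟩ := hverts.subset h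
    exact hu (hverts.superset ⟨a.swap, by rw [← hswap, ha, partner_partner]⟩)
  refine ⟨k, hasPerfectMatching_of_involution partner partner_partner adj_partner, ⟨M, hM⟩,
    f.toSubgraph, ?_, ?_⟩
  · exact hasPerfectMatching_of_involution (fun u => ⟨partner u.1, hcompl u⟩)
      (fun u => Subtype.ext (partner_partner u.1)) fun u => adj_partner u.1
  · exact (T.comapIso f.isoToSubgraph.symm).bicontractsTo

end MatchingMinors

theorem mainTheorem3 {V : Type*} [Finite V] (H : SimpleGraph V)
    (hbip : H.IsBipartite) (hplanar : MatchingMinors.IsPlanar H)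
    (hpm : MatchingMinors.HasPerfectMatching H) (hcov : MatchingMinors.IsMatchingCovered H) :
    ∃ ω : ℕ, MatchingMinors.IsMatchingMinor H (MatchingMinors.cylindricalMatchingGrid ω) := by
  obtain ⟨col⟩ := hbip
  have hcol : ∀ {v w}, H.Adj v w → (col v = 0 ↔ ¬ col w = 0) := by
    intro v w h
    have := col.valid h
    omega
  obtain ⟨B, -, hfin, hsc, hdis, hB⟩ := hplanar.exists_gridModel hcol
  exact MatchingMinors.isMatchingMinor_of_gridModel hcol hpm hfin hsc hdis hB
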